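/- Let $M$ be a connected smooth $n$-dimensional Riemannian manifold (without boundary) with Riemannian distance $d$, let $f_1,f_2$ be smooth time-varying vector fields on $M$ (that is, $f_i(x,t)\in T_xM$ depends smoothly on $(x,t)\in M\times\mathbb{R}$), let $x_0\in M$ and let $t_0\le t_1$ be real numbers. For $\epsilon\ge 0$ let $\Phi_{\epsilon f_i}(\cdot,t_0,x_0)$ denote the solution of $$\dot z(t)=\epsilon f_i(z(t),t),\qquad z(t_0)=x_0 .$$ Suppose that there is $\epsilon_1>0$ such that for every $\epsilon\in[0,\epsilon_1]$ and $i=1,2$ the solution $\Phi_{\epsilon f_i}(\cdot,t_0,x_0)$ exists on the whole interval $[t_0,t_1]$ (which does not depend on $\epsilon$). Then there is a constant $C\ge 0$, independent of $\epsilon$ and $t$, such that $$d\big(\Phi_{\epsilon f_1}(t,t_0,x_0),\Phi_{\epsilon f_2}(t,t_0,x_0)\big)\le C\,\epsilon\qquad\text{for all }\epsilon\in(0,\epsilon_1]\text{ and all }t\in[t_0,t_1].$$ -/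

import Mathlib

open Set Manifold Bundle
open scoped ContDiff

/-- A time-varying vector field `(x, t) ↦ f(x, t) ∈ T_x M` on an `n`-dimensional manifold is smooth
if it is `C^∞` jointly in `(x, t)`, as a map from `M × ℝ` to the tangent bundle `TM`. -/
def IsSmoothTimeVaryingField {n : ℕ} {M : Type*} [TopologicalSpace M]
    [ChartedSpace (EuclideanSpace ℝ (Fin n)) M] [IsManifold (𝓡 n) ∞ M]
    (f : (x : M) → ℝ → TangentSpace (𝓡 n) x) : Prop :=
  ContMDiff ((𝓡 n).prod 𝓘(ℝ, ℝ)) (𝓡 n).tangent ∞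
    (fun p : M × ℝ => (⟨p.1, f p.1 p.2⟩ : TangentBundle (𝓡 n) M))

/-- The curve `γ` solves `γ'(t) = f(γ(t), t)` on `[t₀, t₁]` with `γ(t₀) = x₀`, that is,
`γ(t) = Φ_f(t, t₀, x₀)` for `t ∈ [t₀, t₁]`. Derivatives at the endpoints are one-sided, and the
values of `γ` outside `[t₀, t₁]` are irrelevant. -/
structure IsFlowCurveOn {n : ℕ} {M : Type*} [TopologicalSpace M]
    [ChartedSpace (EuclideanSpace ℝ (Fin n)) M]
    (f : (x : M) → ℝ → TangentSpace (𝓡 n) x) (t₀ t₁ : ℝ) (x₀ : M) (γ : ℝ → M) : Prop where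
  initial : γ t₀ = x₀
  hasDeriv : ∀ t ∈ Icc t₀ t₁, HasMFDerivWithinAt 𝓘(ℝ, ℝ) (𝓡 n) γ (Icc t₀ t₁) t
    ((1 : ℝ →L[ℝ] ℝ).smulRight (f (γ t) t))

/-
The trajectories of `ε • f` issued from `x₀`, for `ε` in a compact set of parameters, sweep out a
compact subset of `M`, because solutions depend jointly continuously on the parameter and on time.
Hence `‖f‖` is bounded along all of them by a single constant `C`, and since the trajectory of
parameter `ε` has speed `|ε| ‖f‖`, it stays within Riemannian distance `C |ε| (t₁ - t₀)` of `x₀`.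
Both trajectories start at `x₀`, so the triangle inequality through `x₀` gives the bound.

Joint continuity is local. While two trajectories stay in a ball of a chart, Gronwall's inequality
controls their distance there, and this control is what prevents the perturbed one from leaving the
ball; finitely many charts cover the reference trajectory.
-/

open Filter Topology MeasureTheory
open scoped NNReal ENNReal

section Interval

variable {a b : ℝ}

lemma mapsTo_Icc_of_bootstrap {X : Type*} [TopologicalSpace X] {u : ℝ → X} {K U : Set X}
    (hu : ContinuousOn u (Icc a b)) (hK : IsClosed K) (hU : IsOpen U) (hKU : K ⊆ U)
    (ha : u a ∈ U) (h : ∀ t ∈ Icc a b, MapsTo u (Icc a t) U → u t ∈ K) :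
    MapsTo u (Icc a b) U := by
  rcases lt_or_ge b a with hba | hab
  · simp only [Icc_eq_empty hba.not_ge, mapsTo_empty]
  have hclosed : IsClosed (u ⁻¹' K ∩ Icc a b) := by
    rw [inter_comm]
    exact hu.preimage_isClosed_of_isClosed isClosed_Icc hK
  have haK : u a ∈ K := h a (left_mem_Icc.2 hab) (by simpa only [Icc_self, mapsTo_singleton])
  have hright : ∀ t ∈ Ico a b, Icc a t ⊆ u ⁻¹' K → u ⁻¹' K ∈ 𝓝[>] t := fun t ht htK => by
    have htI := Ico_subset_Icc_self ht
    have hIcc : Icc a b ∈ 𝓝[≥] t := Icc_mem_nhdsGE_of_mem ht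
    have hnear : u ⁻¹' U ∩ Icc a b ∈ 𝓝[≥] t :=
      inter_mem (((hu t htI).mono_of_mem_nhdsWithin hIcc).preimage_mem_nhdsWithin
        (hU.mem_nhds (hKU (htK (right_mem_Icc.2 ht.1))))) hIcc
    obtain ⟨c, htc, hc⟩ := (mem_nhdsGE_iff_exists_Icc_subset).1 hnear
    filter_upwards [Ioc_mem_nhdsGT htc] with s hs
    refine h s (hc (Ioc_subset_Icc_self hs)).2 fun v hv => ?_
    rcases le_total v t with hvt | htv
    · exact hKU (htK ⟨hv.1, hvt⟩)
    · exact (hc ⟨htv, hv.2.trans hs.2⟩).1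
  exact fun t ht => hKU (hclosed.Icc_subset_of_forall_mem_nhdsGT_of_Icc_subset haK hright ht)

lemma Icc_induction_of_nhdsWithin (hab : a ≤ b) {Q : ℝ → Prop} (ha : Q a)
    (h : ∀ s ∈ Icc a b, ∃ N ∈ 𝓝[Icc a b] s,
      ∀ c d, c ≤ d → Icc c d ⊆ N ∩ Icc a b → Q c → Q d) : Q b := by
  choose! N hN hQ using h
  obtain ⟨τ, hτ₀, hτmono, ⟨m, hm⟩, hτN⟩ := exists_monotone_Icc_subset_open_cover_Icc hab
    (c := fun s : Icc a b => interior (((↑) : Icc a b → ℝ) ⁻¹' N s)) (fun _ => isOpen_interior)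
    (fun s _ => mem_iUnion.2 ⟨s, mem_interior_iff_mem_nhds.2
      (preimage_coe_mem_nhds_subtype.2 (hN s s.2))⟩)
  have hstep : ∀ k, Q (τ k) := fun k => by
    induction k with
    | zero => rwa [hτ₀]
    | succ k ih =>
      obtain ⟨s, hs⟩ := hτN k
      refine hQ s s.2 (τ k) (τ (k + 1)) (hτmono k.le_succ) (fun t ht => ?_) ih
      have htI : t ∈ Icc a b := ⟨(τ k).2.1.trans ht.1, ht.2.trans (τ (k + 1)).2.2⟩
      have htN : (⟨t, htI⟩ : Icc a b) ∈ ((↑) : Icc a b → ℝ) ⁻¹' N s := interior_subset (hs ht)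
      exact ⟨htN, htI⟩
  simpa only [hm m le_rfl] using hstep m

lemma exists_Icc_mem_nhdsWithin_Icc_subset {t : ℝ} (ht : t ∈ Icc a b) {N : Set ℝ}
    (hN : N ∈ 𝓝[Icc a b] t) :
    ∃ c d, t ∈ Icc c d ∧ Icc c d ∈ 𝓝[Icc a b] t ∧ Icc c d ⊆ N ∩ Icc a b := by
  obtain ⟨V, hV, hVN⟩ := mem_nhdsWithin_iff_exists_mem_nhds_inter.1 hN
  obtain ⟨c, d, htcd, hcd, hcdV⟩ := exists_Icc_mem_subset_of_mem_nhds hV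
  refine ⟨c ⊔ a, d ⊓ b, ?_⟩
  rw [← Icc_inter_Icc]
  exact ⟨⟨htcd, ht⟩, inter_mem (mem_nhdsWithin_of_mem_nhds hcd) self_mem_nhdsWithin,
    subset_inter ((inter_subset_inter_left _ hcdV).trans hVN) inter_subset_right⟩

lemma exists_pos_gronwallBound_lt (K x : ℝ) {r : ℝ} (hr : 0 < r) :
    ∃ d > 0, gronwallBound d K d x < r := by
  have hcont : Continuous fun d => gronwallBound d K d x := by
    unfold gronwallBound
    split_ifs <;> fun_prop
  have hlim : ∀ᶠ d in 𝓝[>] (0 : ℝ), gronwallBound d K d x < r :=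
    (hcont.tendsto 0).mono_left nhdsWithin_le_nhds |>.eventually_lt_const
      (by rwa [gronwallBound_ε0_δ0])
  exact (eventually_mem_nhdsWithin.and hlim).exists

end Interval

lemma exists_lipschitzOnWith_left {E T F : Type*}
    [NormedAddCommGroup E] [NormedSpace ℝ E] [NormedAddCommGroup T] [NormedSpace ℝ T]
    [NormedAddCommGroup F] [NormedSpace ℝ F] {g : E × T → F} {B : Set E} {I : Set T}
    (hB : IsCompact B) (hBc : Convex ℝ B) (hI : IsCompact I) (hIc : Convex ℝ I)
    (hg : ContDiffOn ℝ 1 g (B ×ˢ I)) :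
    ∃ L : ℝ≥0, ∀ t ∈ I, LipschitzOnWith L (fun y => g (y, t)) B := by
  obtain ⟨L, hL⟩ := (hg.locallyLipschitzOn (hBc.prod hIc)).exists_lipschitzOnWith_of_compact
    (hB.prod hI)
  refine ⟨L, fun t ht y hy z hz => ?_⟩
  simpa [Prod.edist_eq] using hL (mk_mem_prod hy ht) (mk_mem_prod hz ht)

lemma contMDiff_smul_totalSpace {B F : Type*} {EN HN N EB HB : Type*}
    {W : B → Type*}
    [NormedAddCommGroup EN] [NormedSpace ℝ EN] [TopologicalSpace HN]
    {IN : ModelWithCorners ℝ EN HN} [TopologicalSpace N] [ChartedSpace HN N]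
    [NormedAddCommGroup EB] [NormedSpace ℝ EB] [TopologicalSpace HB]
    {IB : ModelWithCorners ℝ EB HB} [TopologicalSpace B] [ChartedSpace HB B]
    [NormedAddCommGroup F] [NormedSpace ℝ F] [TopologicalSpace (TotalSpace F W)]
    [∀ x, AddCommGroup (W x)] [∀ x, Module ℝ (W x)] [∀ x, TopologicalSpace (W x)]
    [FiberBundle F W] [VectorBundle ℝ F W]
    {k : ℕ∞ω} {b : N → B} {v : (m : N) → W (b m)} {c : N → ℝ}
    (hc : ContMDiff IN 𝓘(ℝ, ℝ) k c)
    (hv : ContMDiff IN (IB.prod 𝓘(ℝ, F)) k fun m => (⟨b m, v m⟩ : TotalSpace F W)) :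
    ContMDiff IN (IB.prod 𝓘(ℝ, F)) k fun m => (⟨b m, c m • v m⟩ : TotalSpace F W) := by
  intro m
  have hvm := contMDiffAt_totalSpace.1 (hv m)
  refine contMDiffAt_totalSpace.2 ⟨hvm.1, ((hc m).smul hvm.2).congr_of_eventuallyEq ?_⟩
  filter_upwards [hvm.1.continuousAt.preimage_mem_nhds
    ((trivializationAt F W (b m)).open_baseSet.mem_nhds (mem_baseSet_trivializationAt F W (b m)))]
    with m' hm'
  exact ((trivializationAt F W (b m)).linear ℝ hm').map_smul (c m') (v m')

section FlowCurve

variable {n : ℕ} {M : Type*} [TopologicalSpace M] [ChartedSpace (EuclideanSpace ℝ (Fin n)) M]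
  {f : (x : M) → ℝ → TangentSpace (𝓡 n) x} {t₀ t₁ : ℝ} {x₀ : M} {γ : ℝ → M}

lemma IsFlowCurveOn.continuousOn (hγ : IsFlowCurveOn f t₀ t₁ x₀ γ) :
    ContinuousOn γ (Icc t₀ t₁) :=
  fun t ht => (hγ.hasDeriv t ht).continuousWithinAt

lemma IsFlowCurveOn.mono {a b : ℝ} (hγ : IsFlowCurveOn f t₀ t₁ x₀ γ)
    (h : Icc a b ⊆ Icc t₀ t₁) :
    IsFlowCurveOn f a b (γ a) γ :=
  ⟨rfl, fun t ht => (hγ.hasDeriv t (h ht)).mono h⟩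

variable [IsManifold (𝓡 n) 1 M]

/-- The `C¹` counterpart of `IsSmoothTimeVaryingField`: the field is `C¹` jointly in `(x, t)`, which
is the regularity that makes its chart expressions locally Lipschitz. -/
def IsC1TimeVaryingField (f : (x : M) → ℝ → TangentSpace (𝓡 n) x) : Prop :=
  ContMDiff ((𝓡 n).prod 𝓘(ℝ, ℝ)) (𝓡 n).tangent 1
    (fun p : M × ℝ => (⟨p.1, f p.1 p.2⟩ : TangentBundle (𝓡 n) M))

/-- The time-varying field `f` read in the preferred chart at `p`, as a function of `(y, t)` with
`y` in the model space: flow curves of `f` become solutions of an ordinary differential equation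
with this right-hand side. It is meaningful only for `y` in the target of the chart. -/
noncomputable def fieldInChart (f : (x : M) → ℝ → TangentSpace (𝓡 n) x) (p : M)
    (q : EuclideanSpace ℝ (Fin n) × ℝ) : EuclideanSpace ℝ (Fin n) :=
  (trivializationAt (EuclideanSpace ℝ (Fin n)) (TangentSpace (𝓡 n)) p
    ⟨(extChartAt (𝓡 n) p).symm q.1, f ((extChartAt (𝓡 n) p).symm q.1) q.2⟩).2

lemma continuousOn_fieldInChart {P : Type*} [TopologicalSpace P]
    {F : P → (x : M) → ℝ → TangentSpace (𝓡 n) x}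
    (hF : Continuous fun q : P × M × ℝ =>
      (⟨q.2.1, F q.1 q.2.1 q.2.2⟩ : TangentBundle (𝓡 n) M)) (p : M) :
    ContinuousOn (fun q : P × EuclideanSpace ℝ (Fin n) × ℝ => fieldInChart (F q.1) p q.2)
      (univ ×ˢ ((extChartAt (𝓡 n) p).target ×ˢ univ)) := by
  have hsymm : ContinuousOn (fun q : P × EuclideanSpace ℝ (Fin n) × ℝ =>
      (q.1, (extChartAt (𝓡 n) p).symm q.2.1, q.2.2))
      (univ ×ˢ ((extChartAt (𝓡 n) p).target ×ˢ univ)) :=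
    continuous_fst.continuousOn.prodMk (((continuousOn_extChartAt_symm p).comp
      (by fun_prop) fun q hq => hq.2.1).prodMk (by fun_prop))
  refine continuous_snd.comp_continuousOn ((trivializationAt (EuclideanSpace ℝ (Fin n))
    (TangentSpace (𝓡 n)) p).continuousOn.comp (hF.comp_continuousOn hsymm) fun q hq => ?_)
  rw [Trivialization.mem_source]
  simpa using (extChartAt (𝓡 n) p).map_target hq.2.1

lemma IsFlowCurveOn.hasDerivWithinAt_extChartAt (hγ : IsFlowCurveOn f t₀ t₁ x₀ γ) {p : M}
    {t : ℝ} (ht : t ∈ Icc t₀ t₁) (hp : γ t ∈ (extChartAt (𝓡 n) p).source) :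
    HasDerivWithinAt (extChartAt (𝓡 n) p ∘ γ)
      (fieldInChart f p (extChartAt (𝓡 n) p (γ t), t)) (Icc t₀ t₁) t := by
  have hp' : γ t ∈ (chartAt (EuclideanSpace ℝ (Fin n)) p).source := by
    simpa only [extChartAt_source] using hp
  set A := (trivializationAt (EuclideanSpace ℝ (Fin n)) (TangentSpace (𝓡 n))
    p).continuousLinearMapAt ℝ (γ t)
  have hfield : fieldInChart f p (extChartAt (𝓡 n) p (γ t), t) = A (f (γ t) t) := by
    rw [fieldInChart, PartialEquiv.left_inv _ hp, Trivialization.continuousLinearMapAt_apply,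
      Trivialization.coe_linearMapAt_of_mem _ (by simpa using hp')]
  have hchain := (mdifferentiableAt_extChartAt (I := 𝓡 n) hp').hasMFDerivAt.comp_hasMFDerivWithinAt
    t (hγ.hasDeriv t ht)
  rw [← TangentBundle.continuousLinearMapAt_trivializationAt hp'] at hchain
  rw [hfield, hasDerivWithinAt_iff_hasFDerivWithinAt]
  refine (hasMFDerivWithinAt_iff_hasFDerivWithinAt.1 hchain).congr_fderiv ?_
  exact ContinuousLinearMap.ext fun s : ℝ => map_smul A s (f (γ t) t)

lemma IsFlowCurveOn.contMDiffOn
    (hf : Continuous fun q : M × ℝ => (⟨q.1, f q.1 q.2⟩ : TangentBundle (𝓡 n) M))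
    (hγ : IsFlowCurveOn f t₀ t₁ x₀ γ) :
    ContMDiffOn 𝓘(ℝ, ℝ) (𝓡 n) 1 γ (Icc t₀ t₁) := by
  intro t ht
  rw [contMDiffWithinAt_iff_target]
  refine ⟨hγ.continuousOn t ht, ?_⟩
  rw [contMDiffWithinAt_iff_contDiffWithinAt]
  set φ := extChartAt (𝓡 n) (γ t)
  set N := Icc t₀ t₁ ∩ γ ⁻¹' φ.source
  have hN : N ∈ 𝓝[Icc t₀ t₁] t :=
    inter_mem self_mem_nhdsWithin ((hγ.continuousOn t ht).preimage_mem_nhdsWithin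
      (extChartAt_source_mem_nhds (γ t)))
  have hφγ : ContinuousOn (φ ∘ γ) N :=
    (continuousOn_extChartAt (γ t)).comp (hγ.continuousOn.mono inter_subset_left) fun s hs => hs.2
  have hderiv : ContinuousOn (fun s => fieldInChart f (γ t) (φ (γ s), s)) N :=
    (continuousOn_fieldInChart (F := fun _ : Unit => f) (hf.comp continuous_snd) (γ t)).comp
      (f := fun s => ((), φ (γ s), s)) (continuousOn_const.prodMk (hφγ.prodMk continuousOn_id))
      fun s hs => ⟨mem_univ _, φ.map_source hs.2, mem_univ _⟩
  rw [show (1 : WithTop ℕ∞) = 0 + 1 by simp, contDiffWithinAt_succ_iff_hasFDerivWithinAt (by simp)]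
  refine ⟨N, by rwa [insert_eq_of_mem ht], by simp, _, fun s hs =>
    (hγ.hasDerivWithinAt_extChartAt hs.1 hs.2).hasFDerivWithinAt.mono inter_subset_left, ?_⟩
  exact (contDiffOn_zero.2 ((ContinuousLinearMap.smulRightL ℝ ℝ (EuclideanSpace ℝ (Fin n))
    1).continuous.comp_continuousOn hderiv)).contDiffWithinAt (mem_of_mem_nhdsWithin ht hN)

lemma IsFlowCurveOn.riemannianEDist_le [RiemannianBundle (fun x : M => TangentSpace (𝓡 n) x)]
    (hf : Continuous fun q : M × ℝ => (⟨q.1, f q.1 q.2⟩ : TangentBundle (𝓡 n) M))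
    (hγ : IsFlowCurveOn f t₀ t₁ x₀ γ) {C : ℝ≥0∞} {t : ℝ}
    (hC : ∀ s ∈ Icc t₀ t, ‖f (γ s) s‖ₑ ≤ C) (ht : t ∈ Icc t₀ t₁) :
    riemannianEDist (𝓡 n) x₀ (γ t) ≤ C * ENNReal.ofReal (t - t₀) := by
  have hγt := hγ.mono (Icc_subset_Icc_right ht.2)
  rcases ht.1.eq_or_lt with rfl | hlt
  · simp [hγ.initial, riemannianEDist_self]
  have hspeed : ∀ s ∈ Icc t₀ t, ‖mfderivWithin 𝓘(ℝ, ℝ) (𝓡 n) γ (Icc t₀ t) s 1‖ₑ ≤ C := by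
    intro s hs
    have hd : mfderivWithin 𝓘(ℝ, ℝ) (𝓡 n) γ (Icc t₀ t) s 1 = f (γ s) s := by
      rw [(hγt.hasDeriv s hs).mfderivWithin (uniqueDiffOn_Icc hlt s hs).uniqueMDiffWithinAt]
      exact one_smul ℝ (f (γ s) s)
    exact hd ▸ hC s hs
  calc riemannianEDist (𝓡 n) x₀ (γ t)
      ≤ pathELength (𝓡 n) γ t₀ t :=
        riemannianEDist_le_pathELength (hγt.contMDiffOn hf) hγ.initial rfl ht.1
    _ ≤ ∫⁻ _ in Icc t₀ t, C := by
        rw [pathELength_eq_lintegral_mfderivWithin_Icc]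
        exact setLIntegral_mono' measurableSet_Icc hspeed
    _ = C * ENNReal.ofReal (t - t₀) := by rw [setLIntegral_const, Real.volume_Icc]

end FlowCurve

section ChartComparison

variable {n : ℕ} {M : Type*} [TopologicalSpace M] [ChartedSpace (EuclideanSpace ℝ (Fin n)) M]
  [IsManifold (𝓡 n) 1 M] {f g : (x : M) → ℝ → TangentSpace (𝓡 n) x} {p x y : M}
  {a b d η : ℝ} {γ δ : ℝ → M} {L : ℝ≥0}

lemma IsFlowCurveOn.dist_extChartAt_le_gronwallBound {B : Set (EuclideanSpace ℝ (Fin n))}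
    (hγ : IsFlowCurveOn f a b x γ) (hδ : IsFlowCurveOn g a b y δ)
    (hL : ∀ t ∈ Icc a b, LipschitzOnWith L (fun z => fieldInChart g p (z, t)) B)
    (hη : ∀ t ∈ Icc a b, ∀ z ∈ B, dist (fieldInChart f p (z, t)) (fieldInChart g p (z, t)) ≤ η)
    (hγB : MapsTo γ (Icc a b) ((extChartAt (𝓡 n) p).source ∩ extChartAt (𝓡 n) p ⁻¹' B))
    (hδB : MapsTo δ (Icc a b) ((extChartAt (𝓡 n) p).source ∩ extChartAt (𝓡 n) p ⁻¹' B))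
    (hd : dist (extChartAt (𝓡 n) p (γ a)) (extChartAt (𝓡 n) p (δ a)) ≤ d) :
    ∀ t ∈ Icc a b, dist (extChartAt (𝓡 n) p (γ t)) (extChartAt (𝓡 n) p (δ t)) ≤
      gronwallBound d L η (t - a) := by
  have hIco : ∀ {t}, t ∈ Ico a b → t ∈ Icc a b := fun ht => Ico_subset_Icc_self ht
  have hγ' := fun t (ht : t ∈ Icc a b) => hγ.hasDerivWithinAt_extChartAt ht (hγB ht).1
  have hδ' := fun t (ht : t ∈ Icc a b) => hδ.hasDerivWithinAt_extChartAt ht (hδB ht).1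
  have hgronwall := dist_le_of_approx_trajectories_ODE_of_mem
    (v := fun t z => fieldInChart g p (z, t)) (s := fun _ => B) (εf := η) (εg := 0)
    (fun t ht => hL t (hIco ht))
    (fun t ht => (hγ' t ht).continuousWithinAt)
    (fun t ht => (hγ' t (hIco ht)).mono_of_mem_nhdsWithin (Icc_mem_nhdsGE_of_mem ht))
    (fun t ht => hη t (hIco ht) _ (hγB (hIco ht)).2)
    (fun t ht => (hγB (hIco ht)).2)
    (fun t ht => (hδ' t ht).continuousWithinAt)
    (fun t ht => (hδ' t (hIco ht)).mono_of_mem_nhdsWithin (Icc_mem_nhdsGE_of_mem ht))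
    (fun t _ => (dist_self _).le)
    (fun t ht => (hδB (hIco ht)).2) hd
  simpa only [add_zero, Function.comp_apply] using hgronwall

lemma IsFlowCurveOn.mapsTo_extChartAt_ball [T2Space M] {ρ r : ℝ}
    (hγ : IsFlowCurveOn f a b x γ) (hδ : IsFlowCurveOn g a b y δ)
    (hr : Metric.closedBall (extChartAt (𝓡 n) p p) r ⊆ (extChartAt (𝓡 n) p).target)
    (hL : ∀ t ∈ Icc a b, LipschitzOnWith L (fun z => fieldInChart g p (z, t))
      (Metric.closedBall (extChartAt (𝓡 n) p p) r))
    (hη : ∀ t ∈ Icc a b, ∀ z ∈ Metric.closedBall (extChartAt (𝓡 n) p p) r,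
      dist (fieldInChart f p (z, t)) (fieldInChart g p (z, t)) ≤ η)
    (hη₀ : 0 ≤ η)
    (hδρ : MapsTo δ (Icc a b) ((extChartAt (𝓡 n) p).source ∩
      extChartAt (𝓡 n) p ⁻¹' Metric.closedBall (extChartAt (𝓡 n) p p) ρ))
    (ha : γ a ∈ (extChartAt (𝓡 n) p).source)
    (hd : dist (extChartAt (𝓡 n) p (γ a)) (extChartAt (𝓡 n) p (δ a)) ≤ d)
    (hgap : ρ + gronwallBound d L η (b - a) < r) :
    MapsTo γ (Icc a b) ((extChartAt (𝓡 n) p).source ∩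
      extChartAt (𝓡 n) p ⁻¹' Metric.ball (extChartAt (𝓡 n) p p) r) := by
  set φ := extChartAt (𝓡 n) p
  set G := gronwallBound d L η (b - a)
  rcases lt_or_ge b a with hba | hab
  · simp only [Icc_eq_empty hba.not_ge, mapsTo_empty]
  have hd₀ : 0 ≤ d := dist_nonneg.trans hd
  have hmono := gronwallBound_mono hd₀ hη₀ L.2
  have hdG : d ≤ G := (gronwallBound_x0 d L η).ge.trans (hmono (sub_nonneg.2 hab))
  have hball : ∀ {z w}, dist z w ≤ G → w ∈ Metric.closedBall (φ p) ρ → dist z (φ p) ≤ ρ + G := by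
    intro z w hz hw
    linarith [dist_triangle z w (φ p), Metric.mem_closedBall.1 hw]
  have hsub : Metric.closedBall (φ p) (ρ + G) ⊆ φ.target :=
    (Metric.closedBall_subset_closedBall hgap.le).trans hr
  have hK : IsCompact (φ.symm '' Metric.closedBall (φ p) (ρ + G)) :=
    (isCompact_closedBall _ _).image_of_continuousOn ((continuousOn_extChartAt_symm p).mono hsub)
  have hU : IsOpen (φ.source ∩ φ ⁻¹' Metric.ball (φ p) r) :=
    isOpen_extChartAt_preimage' p Metric.isOpen_ball
  refine mapsTo_Icc_of_bootstrap hγ.continuousOn hK.isClosed hU ?_ ⟨ha, ?_⟩ fun t ht hγU => ?_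
  · rintro _ ⟨z, hz, rfl⟩
    refine ⟨φ.map_target (hsub hz), ?_⟩
    rw [mem_preimage, φ.right_inv (hsub hz)]
    exact Metric.closedBall_subset_ball hgap hz
  · exact (hball (hd.trans hdG) (hδρ (left_mem_Icc.2 hab)).2).trans_lt hgap
  · have hIcc : Icc a t ⊆ Icc a b := Icc_subset_Icc_right ht.2
    have hG : dist (φ (γ t)) (φ (δ t)) ≤ G := by
      refine ((hγ.mono hIcc).dist_extChartAt_le_gronwallBound (hδ.mono hIcc)
        (B := Metric.closedBall (φ p) r) (fun s hs => hL s (hIcc hs)) (fun s hs => hη s (hIcc hs))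
        (fun s hs => ?_) (fun s hs => ?_) hd t (right_mem_Icc.2 ht.1)).trans
        (hmono (sub_le_sub_right ht.2 a))
      · exact ⟨(hγU hs).1, Metric.ball_subset_closedBall (hγU hs).2⟩
      · exact ⟨(hδρ (hIcc hs)).1, Metric.closedBall_subset_closedBall (by linarith)
          (hδρ (hIcc hs)).2⟩
    exact ⟨_, hball hG (hδρ ht).2, φ.left_inv (hγU (right_mem_Icc.2 ht.1)).1⟩

end ChartComparison

section Dependence

variable {n : ℕ} {M : Type*} [TopologicalSpace M] [ChartedSpace (EuclideanSpace ℝ (Fin n)) M]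
  {P : Type*} [TopologicalSpace P] {F : P → (x : M) → ℝ → TangentSpace (𝓡 n) x}
  {Φ : P → ℝ → M} {e : P} {a b : ℝ}

lemma eventually_dist_fieldInChart_lt [IsManifold (𝓡 n) 1 M]
    (hF : Continuous fun q : P × M × ℝ =>
      (⟨q.2.1, F q.1 q.2.1 q.2.2⟩ : TangentBundle (𝓡 n) M)) (e : P)
    {p : M} {K : Set (EuclideanSpace ℝ (Fin n) × ℝ)} (hK : IsCompact K)
    (hKt : K ⊆ (extChartAt (𝓡 n) p).target ×ˢ univ) {d : ℝ} (hd : 0 < d) :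
    ∀ᶠ ε in 𝓝 e, ∀ q ∈ K, dist (fieldInChart (F ε) p q) (fieldInChart (F e) p q) < d := by
  obtain ⟨v, hv, hvd⟩ := hK.mem_uniformity_of_prod
    (f := fun ε q => fieldInChart (F ε) p q)
    ((continuousOn_fieldInChart hF p).mono (prod_mono_right hKt)) (mem_univ e)
    (Metric.dist_mem_uniformity hd)
  rw [nhdsWithin_univ] at hv
  filter_upwards [hv] with ε hε q hq using hvd ε hε q hq

variable [IsManifold (𝓡 n) 2 M]

lemma IsC1TimeVaryingField.contDiffOn_fieldInChart {f : (x : M) → ℝ → TangentSpace (𝓡 n) x}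
    (hf : IsC1TimeVaryingField f) (p : M) :
    ContDiffOn ℝ 1 (fieldInChart f p) ((extChartAt (𝓡 n) p).target ×ˢ univ) := by
  have hsymm : ContMDiffOn (𝓘(ℝ, EuclideanSpace ℝ (Fin n) × ℝ)) ((𝓡 n).prod 𝓘(ℝ, ℝ)) 1
      (fun q : EuclideanSpace ℝ (Fin n) × ℝ => ((extChartAt (𝓡 n) p).symm q.1, q.2))
      ((extChartAt (𝓡 n) p).target ×ˢ univ) :=
    ((contMDiffOn_extChartAt_symm p).comp contDiff_fst.contMDiff.contMDiffOn
      fun q hq => hq.1).prodMk contDiff_snd.contMDiff.contMDiffOn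
  have htriv := (trivializationAt (EuclideanSpace ℝ (Fin n))
    (TangentSpace (𝓡 n) : M → Type _) p).contMDiffOn (IB := 𝓡 n) (n := 1)
  refine (contMDiff_snd.comp_contMDiffOn (htriv.comp (hf.comp_contMDiffOn hsymm)
    fun q hq => ?_)).contDiffOn
  rw [mem_preimage, Trivialization.mem_source]
  simpa using (extChartAt (𝓡 n) p).map_target hq.1

lemma eventually_mapsTo_and_dist_extChartAt_lt [T2Space M]
    (hF : Continuous fun q : P × M × ℝ =>
      (⟨q.2.1, F q.1 q.2.1 q.2.2⟩ : TangentBundle (𝓡 n) M))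
    (hFe : IsC1TimeVaryingField (F e)) (hab : a ≤ b)
    (hΦ : ∀ ε, IsFlowCurveOn (F ε) a b (Φ ε a) (Φ ε)) {p : M} {ρ r σ : ℝ}
    (hr : Metric.closedBall (extChartAt (𝓡 n) p p) r ⊆ (extChartAt (𝓡 n) p).target)
    (hρr : ρ < r) (hσ : 0 < σ)
    (hΦe : MapsTo (Φ e) (Icc a b) ((extChartAt (𝓡 n) p).source ∩
      extChartAt (𝓡 n) p ⁻¹' Metric.closedBall (extChartAt (𝓡 n) p p) ρ))
    (ha : Tendsto (fun ε => Φ ε a) (𝓝 e) (𝓝 (Φ e a))) :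
    ∀ᶠ ε in 𝓝 e, MapsTo (Φ ε) (Icc a b) (extChartAt (𝓡 n) p).source ∧ ∀ t ∈ Icc a b,
      dist (extChartAt (𝓡 n) p (Φ ε t)) (extChartAt (𝓡 n) p (Φ e t)) < σ := by
  set φ := extChartAt (𝓡 n) p
  set B := Metric.closedBall (φ p) r
  have hB : IsCompact B := isCompact_closedBall _ _
  have hBt : B ×ˢ Icc a b ⊆ φ.target ×ˢ univ := prod_mono hr (subset_univ _)
  have hea := (hΦe (left_mem_Icc.2 hab)).1
  obtain ⟨L, hL⟩ := exists_lipschitzOnWith_left hB (convex_closedBall _ _)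
    isCompact_Icc (convex_Icc a b) ((hFe.contDiffOn_fieldInChart p).mono hBt)
  obtain ⟨d, hd, hgap⟩ := exists_pos_gronwallBound_lt L (b - a) (lt_min hσ (sub_pos.2 hρr))
  have hfield := eventually_dist_fieldInChart_lt hF e (hB.prod isCompact_Icc) hBt hd
  have hsource := ha.eventually ((isOpen_extChartAt_source (I := 𝓡 n) p).mem_nhds hea)
  have hinitial := ((continuousAt_extChartAt' hea).tendsto.comp ha).eventually
    (Metric.closedBall_mem_nhds _ hd)
  filter_upwards [hfield, hsource, hinitial] with ε hεf hεs hεd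
  have hη : ∀ t ∈ Icc a b, ∀ z ∈ B,
      dist (fieldInChart (F ε) p (z, t)) (fieldInChart (F e) p (z, t)) ≤ d :=
    fun t ht z hz => (hεf (z, t) ⟨hz, ht⟩).le
  have hmaps := (hΦ ε).mapsTo_extChartAt_ball (hΦ e) hr hL hη hd.le hΦe hεs hεd
    (by linarith [hgap.trans_le (min_le_right _ _)])
  refine ⟨fun t ht => (hmaps ht).1, fun t ht => ?_⟩
  calc dist (φ (Φ ε t)) (φ (Φ e t))
      ≤ gronwallBound d L d (t - a) :=
        (hΦ ε).dist_extChartAt_le_gronwallBound (hΦ e) hL hη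
          (hmaps.mono_right (inter_subset_inter_right _
            (preimage_mono Metric.ball_subset_closedBall)))
          (hΦe.mono_right (inter_subset_inter_right _
            (preimage_mono (Metric.closedBall_subset_closedBall hρr.le)))) hεd t ht
    _ ≤ gronwallBound d L d (b - a) :=
        gronwallBound_mono hd.le hd.le L.2 (sub_le_sub_right ht.2 a)
    _ < σ := hgap.trans_le (min_le_left _ _)

lemma exists_mem_nhds_tendsto_flow [T2Space M]
    (hF : Continuous fun q : P × M × ℝ =>
      (⟨q.2.1, F q.1 q.2.1 q.2.2⟩ : TangentBundle (𝓡 n) M))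
    (hFe : IsC1TimeVaryingField (F e)) (p : M) :
    ∃ V ∈ 𝓝 p, ∀ a b : ℝ, (∀ ε, IsFlowCurveOn (F ε) a b (Φ ε a) (Φ ε)) →
      MapsTo (Φ e) (Icc a b) V → Tendsto (fun ε => Φ ε a) (𝓝 e) (𝓝 (Φ e a)) → ∀ t ∈ Icc a b,
      Tendsto (fun q : P × ℝ => Φ q.1 q.2) (𝓝 e ×ˢ 𝓝[Icc a b] t) (𝓝 (Φ e t)) := by
  set φ := extChartAt (𝓡 n) p
  obtain ⟨r, hr₀, hr⟩ := Metric.nhds_basis_closedBall.mem_iff.1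
    ((isOpen_extChartAt_target (I := 𝓡 n) p).mem_nhds (mem_extChartAt_target p))
  refine ⟨φ.source ∩ φ ⁻¹' Metric.closedBall (φ p) (r / 2), inter_mem
    (extChartAt_source_mem_nhds p) (continuousAt_extChartAt p |>.preimage_mem_nhds
      (Metric.closedBall_mem_nhds _ (half_pos hr₀))), fun a b hΦ hΦe ha t ht => ?_⟩
  have hclose := fun σ (hσ : 0 < σ) => eventually_mapsTo_and_dist_extChartAt_lt hF hFe
    (ht.1.trans ht.2) hΦ hr (half_lt_self hr₀) hσ hΦe ha
  have hunif : TendstoUniformlyOn (fun (q : P × ℝ) s => φ (Φ q.1 s)) (fun s => φ (Φ e s))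
      (𝓝 e ×ˢ 𝓝[Icc a b] t) (Icc a b) := by
    refine Metric.tendstoUniformlyOn_iff.2 fun σ hσ => ?_
    filter_upwards [(hclose σ hσ).prod_inl _] with q hq s hs
    exact dist_comm (φ (Φ q.1 s)) _ ▸ hq.2 s hs
  have hcont : ContinuousWithinAt (fun s => φ (Φ e s)) (Icc a b) t :=
    (continuousAt_extChartAt' (hΦe ht).1).comp_continuousWithinAt ((hΦ e).continuousOn t ht)
  have hlim : Tendsto (fun q : P × ℝ => φ (Φ q.1 q.2)) (𝓝 e ×ˢ 𝓝[Icc a b] t) (𝓝 (φ (Φ e t))) :=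
    hunif.tendsto_comp hcont tendsto_snd
  refine (((continuousAt_extChartAt_symm' (hΦe ht).1).tendsto.comp hlim).congr' ?_).mono_right
    (by rw [φ.left_inv (hΦe ht).1])
  filter_upwards [(hclose 1 one_pos).prod_inl _, eventually_mem_nhdsWithin.prod_inr _] with q hq hqt
  exact φ.left_inv (hq.1 hqt)

theorem continuousOn_flow [T2Space M]
    (hF : Continuous fun q : P × M × ℝ =>
      (⟨q.2.1, F q.1 q.2.1 q.2.2⟩ : TangentBundle (𝓡 n) M))
    (hFC1 : ∀ ε, IsC1TimeVaryingField (F ε)) {x : P → M} (hx : Continuous x)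
    (hΦ : ∀ ε, IsFlowCurveOn (F ε) a b (x ε) (Φ ε)) :
    ContinuousOn (fun q : P × ℝ => Φ q.1 q.2) (univ ×ˢ Icc a b) := by
  rintro ⟨e, t⟩ ⟨-, ht⟩
  have hlocal : ∀ s ∈ Icc a b, ∃ N ∈ 𝓝[Icc a b] s, ∀ c d, Icc c d ⊆ N ∩ Icc a b →
      Tendsto (fun ε => Φ ε c) (𝓝 e) (𝓝 (Φ e c)) → ∀ u ∈ Icc c d,
      Tendsto (fun q : P × ℝ => Φ q.1 q.2) (𝓝 e ×ˢ 𝓝[Icc c d] u) (𝓝 (Φ e u)) := fun s hs => by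
    obtain ⟨V, hV, hVΦ⟩ := exists_mem_nhds_tendsto_flow (Φ := Φ) hF (hFC1 e) (Φ e s)
    exact ⟨_, ((hΦ e).continuousOn s hs).preimage_mem_nhdsWithin hV, fun c d hcd =>
      hVΦ c d (fun ε => (hΦ ε).mono (hcd.trans inter_subset_right)) fun u hu => (hcd hu).1⟩
  have hslice : ∀ s ∈ Icc a b, Tendsto (fun ε => Φ ε s) (𝓝 e) (𝓝 (Φ e s)) := fun s hs => by
    refine Icc_induction_of_nhdsWithin hs.1
      (Q := fun s => Tendsto (fun ε => Φ ε s) (𝓝 e) (𝓝 (Φ e s))) ?_ fun u hu => ?_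
    · simpa only [fun ε => (hΦ ε).initial] using hx.tendsto e
    · have hsub : Icc a s ⊆ Icc a b := Icc_subset_Icc_right hs.2
      obtain ⟨N, hN, hNΦ⟩ := hlocal u (hsub hu)
      refine ⟨N, nhdsWithin_mono u hsub hN, fun c d hcd hcdN hc => ?_⟩
      have hd := right_mem_Icc.2 hcd
      exact (hNΦ c d (hcdN.trans (inter_subset_inter_right N hsub)) hc d hd).comp
        (tendsto_id.prodMk (tendsto_const_pure.mono_right (pure_le_nhdsWithin hd)))
  obtain ⟨N, hN, hNΦ⟩ := hlocal t ht
  obtain ⟨c, d, htcd, hcd, hcdN⟩ := exists_Icc_mem_nhdsWithin_Icc_subset ht hN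
  have hc := hslice c (hcdN (left_mem_Icc.2 (htcd.1.trans htcd.2))).2
  rw [ContinuousWithinAt, nhdsWithin_prod_eq, nhdsWithin_univ]
  exact (hNΦ c d hcdN hc t htcd).mono_left (Filter.prod_mono_right _ (nhdsWithin_le_of_mem hcd))

end Dependence

lemma isContinuousRiemannianBundle_of_isContMDiffRiemannianBundle {EB HB B F : Type*}
    [NormedAddCommGroup EB] [NormedSpace ℝ EB] [TopologicalSpace HB]
    {IB : ModelWithCorners ℝ EB HB} [TopologicalSpace B] [ChartedSpace HB B]
    [NormedAddCommGroup F] [NormedSpace ℝ F] {W : B → Type*} [TopologicalSpace (TotalSpace F W)]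
    [∀ x, NormedAddCommGroup (W x)] [∀ x, InnerProductSpace ℝ (W x)] [FiberBundle F W]
    [VectorBundle ℝ F W] {k : ℕ∞ω} [h : IsContMDiffRiemannianBundle IB k F W] :
    IsContinuousRiemannianBundle F W :=
  let ⟨g, hg, hinner⟩ := h.exists_contMDiff
  ⟨g, hg.continuous, hinner⟩

section LinearBound

variable {n : ℕ} {M : Type*} [TopologicalSpace M]
  [ChartedSpace (EuclideanSpace ℝ (Fin n)) M] [IsManifold (𝓡 n) 2 M]
  [RiemannianBundle (fun x : M => TangentSpace (𝓡 n) x)]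
  [IsContinuousRiemannianBundle (EuclideanSpace ℝ (Fin n)) (fun x : M => TangentSpace (𝓡 n) x)]

lemma IsC1TimeVaryingField.continuous_norm {f : (x : M) → ℝ → TangentSpace (𝓡 n) x}
    (hf : IsC1TimeVaryingField f) : Continuous fun q : M × ℝ => ‖f q.1 q.2‖ := by
  have hsq := (hf.continuous.inner_bundle hf.continuous).sqrt
  simpa only [real_inner_self_eq_norm_sq, Real.sqrt_sq (norm_nonneg _)] using hsq

lemma exists_riemannianEDist_le_mul_abs [T2Space M] {f : (x : M) → ℝ → TangentSpace (𝓡 n) x}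
    (hf : IsC1TimeVaryingField f) {x₀ : M} {t₀ t₁ : ℝ} {S : Set ℝ} (hS : IsCompact S)
    {Φ : ℝ → ℝ → M}
    (hΦ : ∀ ε ∈ S, IsFlowCurveOn (fun x t => ε • f x t) t₀ t₁ x₀ (Φ ε)) :
    ∃ C : ℝ, 0 ≤ C ∧ ∀ ε ∈ S, ∀ t ∈ Icc t₀ t₁,
      riemannianEDist (𝓡 n) x₀ (Φ ε t) ≤ ENNReal.ofReal (C * |ε|) := by
  have : CompactSpace S := isCompact_iff_compactSpace.1 hS
  have hscaled : Continuous fun q : S × M × ℝ =>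
      (⟨q.2.1, (q.1 : ℝ) • f q.2.1 q.2.2⟩ : TangentBundle (𝓡 n) M) :=
    (contMDiff_smul_totalSpace (c := fun q : ℝ × M × ℝ => q.1) contMDiff_fst
      (hf.comp contMDiff_snd)).continuous.comp (continuous_subtype_val.prodMap continuous_id)
  have hC1 : ∀ ε : ℝ, IsC1TimeVaryingField fun x t => ε • f x t :=
    fun _ => contMDiff_smul_totalSpace contMDiff_const hf
  have hflow : ContinuousOn (fun q : S × ℝ => Φ q.1 q.2) (univ ×ˢ Icc t₀ t₁) :=
    continuousOn_flow (F := fun (ε : S) x t => (ε : ℝ) • f x t) (Φ := fun ε : S => Φ ε) hscaled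
      (fun ε => hC1 ε) continuous_const fun ε => hΦ ε ε.2
  have hspeed : ContinuousOn (fun q : S × ℝ => ‖f (Φ q.1 q.2) q.2‖) (univ ×ˢ Icc t₀ t₁) :=
    hf.continuous_norm.comp_continuousOn (hflow.prodMk continuousOn_snd)
  obtain ⟨C, hC⟩ := (isCompact_univ.prod isCompact_Icc).exists_bound_of_continuousOn hspeed
  refine ⟨max C 0 * |t₁ - t₀|, by positivity, fun ε hε t ht => ?_⟩
  have hbound : ∀ s ∈ Icc t₀ t, ‖ε • f (Φ ε s) s‖ₑ ≤ ENNReal.ofReal (|ε| * max C 0) := by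
    intro s hs
    rw [← ofReal_norm, norm_smul, Real.norm_eq_abs]
    gcongr
    exact ((norm_norm _).ge.trans (hC (⟨ε, hε⟩, s) ⟨mem_univ _, hs.1, hs.2.trans ht.2⟩)).trans
      (le_max_left _ _)
  have htime : t - t₀ ≤ |t₁ - t₀| := (sub_le_sub_right ht.2 t₀).trans (le_abs_self _)
  calc riemannianEDist (𝓡 n) x₀ (Φ ε t)
      ≤ ENNReal.ofReal (|ε| * max C 0) * ENNReal.ofReal (t - t₀) :=
        (hΦ ε hε).riemannianEDist_le (hC1 ε).continuous hbound ht
    _ ≤ ENNReal.ofReal (|ε| * max C 0) * ENNReal.ofReal |t₁ - t₀| := by gcongr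
    _ = ENNReal.ofReal (max C 0 * |t₁ - t₀| * |ε|) := by
        rw [← ENNReal.ofReal_mul (by positivity), mul_rotate, mul_right_comm]

theorem lemma4_general [T2Space M] {f₁ f₂ : (x : M) → ℝ → TangentSpace (𝓡 n) x}
    (hf₁ : IsC1TimeVaryingField f₁) (hf₂ : IsC1TimeVaryingField f₂)
    {x₀ : M} {t₀ t₁ : ℝ} {S : Set ℝ} (hS : IsCompact S) {Φ₁ Φ₂ : ℝ → ℝ → M}
    (hΦ₁ : ∀ ε ∈ S, IsFlowCurveOn (fun x t => ε • f₁ x t) t₀ t₁ x₀ (Φ₁ ε))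
    (hΦ₂ : ∀ ε ∈ S, IsFlowCurveOn (fun x t => ε • f₂ x t) t₀ t₁ x₀ (Φ₂ ε)) :
    ∃ C : ℝ, 0 ≤ C ∧ ∀ ε ∈ S, ∀ t ∈ Icc t₀ t₁,
      riemannianEDist (𝓡 n) (Φ₁ ε t) (Φ₂ ε t) ≤ ENNReal.ofReal (C * |ε|) := by
  obtain ⟨C₁, hC₁, h₁⟩ := exists_riemannianEDist_le_mul_abs hf₁ hS hΦ₁
  obtain ⟨C₂, hC₂, h₂⟩ := exists_riemannianEDist_le_mul_abs hf₂ hS hΦ₂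
  refine ⟨C₁ + C₂, add_nonneg hC₁ hC₂, fun ε hε t ht => ?_⟩
  calc riemannianEDist (𝓡 n) (Φ₁ ε t) (Φ₂ ε t)
      ≤ riemannianEDist (𝓡 n) x₀ (Φ₁ ε t) + riemannianEDist (𝓡 n) x₀ (Φ₂ ε t) :=
        riemannianEDist_comm (I := 𝓡 n) (x := x₀) ▸ riemannianEDist_triangle
    _ ≤ ENNReal.ofReal (C₁ * |ε|) + ENNReal.ofReal (C₂ * |ε|) :=
        add_le_add (h₁ ε hε t ht) (h₂ ε hε t ht)
    _ = ENNReal.ofReal ((C₁ + C₂) * |ε|) := by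
        rw [← ENNReal.ofReal_add (by positivity) (by positivity), add_mul]

end LinearBound

theorem lemma4 {n : ℕ} {M : Type*} [TopologicalSpace M] [T2Space M] [ConnectedSpace M]
    [ChartedSpace (EuclideanSpace ℝ (Fin n)) M] [IsManifold (𝓡 n) ∞ M]
    [RiemannianBundle (fun x : M => TangentSpace (𝓡 n) x)]
    [IsContMDiffRiemannianBundle (𝓡 n) ∞ (EuclideanSpace ℝ (Fin n))
      (fun x : M => TangentSpace (𝓡 n) x)]
    (f₁ f₂ : (x : M) → ℝ → TangentSpace (𝓡 n) x)
    (hf₁ : IsSmoothTimeVaryingField f₁) (hf₂ : IsSmoothTimeVaryingField f₂)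
    (x₀ : M) (t₀ t₁ : ℝ) (ε₁ : ℝ) (hε₁ : 0 < ε₁)
    (Φ₁ Φ₂ : ℝ → ℝ → M)
    (hΦ₁ : ∀ ε ∈ Icc 0 ε₁, IsFlowCurveOn (fun x t => ε • f₁ x t) t₀ t₁ x₀ (Φ₁ ε))
    (hΦ₂ : ∀ ε ∈ Icc 0 ε₁, IsFlowCurveOn (fun x t => ε • f₂ x t) t₀ t₁ x₀ (Φ₂ ε)) :
    ∃ C : ℝ, 0 ≤ C ∧ ∀ ε ∈ Ioc 0 ε₁, ∀ t ∈ Icc t₀ t₁,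
      riemannianEDist (𝓡 n) (Φ₁ ε t) (Φ₂ ε t) ≤ ENNReal.ofReal (C * ε) := by
  have : IsContinuousRiemannianBundle (EuclideanSpace ℝ (Fin n))
      (fun x : M => TangentSpace (𝓡 n) x) :=
    isContinuousRiemannianBundle_of_isContMDiffRiemannianBundle (IB := 𝓡 n) (k := ∞)
  obtain ⟨C, hC, hdist⟩ :=
    lemma4_general (hf₁.of_le (by simp)) (hf₂.of_le (by simp)) isCompact_Icc hΦ₁ hΦ₂
  refine ⟨C, hC, fun ε hε t ht => ?_⟩
  simpa only [abs_of_pos hε.1] using hdist ε (Ioc_subset_Icc_self hε) t ht
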